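/- A graph (simple, undirected, with possibly infinitely many vertices) is called \emph{amply regular with parameters} $(n,d,\alpha,\beta)$, where $n\in\mathbb{N}\cup\{\infty\}$ and $d,\alpha,\beta\in\mathbb{N}$, if it has $n$ vertices, every vertex has exactly $d$ neighbours, any two adjacent vertices have exactly $\alpha$ common neighbours, and any two vertices at distance $2$ have exactly $\beta$ common neighbours. Let $G$ be a connected amply regular graph with parameters $(n,d,\alpha,\beta)$ that is neither complete nor empty (edgeless), and suppose that $\alpha\le 6\beta-9$. Then $G$ is finite, and its diameter is at most $4d$. Moreover, for every fixed degree $d$ there are, up to isomorphism, only finitely many connected amply regular graphs of degree $d$, neither complete nor empty, whose parameters satisfy $\alpha\le 6\beta-9$. -/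

import Mathlib

universe u

/-- A (possibly infinite) graph `G` is amply regular with parameters `(n, d, α, β)`, where
`n : ℕ∞` may be `⊤`, if it has `n` vertices, every vertex has exactly `d` neighbours, any two
adjacent vertices have exactly `α` common neighbours, and any two vertices at distance `2` have
exactly `β` common neighbours. (Cardinalities are taken in `ℕ∞`; `G.dist v w = 2` forces `v` and
`w` to be joined by a path.) -/
structure SimpleGraph.IsAmplyRegular {V : Type u} (G : SimpleGraph V)
    (n : ℕ∞) (d α β : ℕ) : Prop where
  card_eq : ENat.card V = n
  degree_eq : ∀ v : V, (G.neighborSet v).encard = (d : ℕ∞)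
  of_adj : ∀ v w : V, G.Adj v w → (G.commonNeighbors v w).encard = (α : ℕ∞)
  of_dist_eq_two : ∀ v w : V, G.dist v w = 2 → (G.commonNeighbors v w).encard = (β : ℕ∞)

/-!
If `α ≤ 6β - 9` and some two vertices of `G` are at distance at least four, then the Bakry–Émery
curvature of `G` is at least `1 / 2`, and a discrete Bonnet–Myers theorem bounds all distances by
`4d`. With bounded degree and bounded
diameter the number of vertices is bounded in terms of `d`, which gives the finiteness statements.

*Bonnet–Myers* (`CurvatureGE.mul_dist_le`). If `CD(κ, ∞)` holds with `κ > 0`, then a step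
`f ↦ f + ε Δ f` multiplies the supremum of the squared gradient by at most `1 - 2κε + O(ε²)`.
Iterating from the distance function to a vertex, the gradient tends to `0`, while every value
moves by at most a geometric series, whose sum is about `d / κ`. So distances are at most `2d / κ`.
No semigroup on an infinite graph is needed, as the scheme is discrete in time.

*Curvature* (`IsAmplyRegular.curvatureGE`). For an amply regular graph, minimising `2 Γ₂ f x` over
the values of `f` at distance two from `x` leaves the quadratic form
`(2 + α/2 + d (1 - 2/β)) I + (2/β) (A² - αA) - (1 - 2/β) J` on the neighbourhood of `x`, with `A`
the adjacency operator of this neighbourhood and `J` the all-ones matrix. Since `A` is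
`α`-regular and `A² - αA ≥ -α²/4`, the curvature is at least the smaller of `2` and
`2 + α/2 + d (1 - 2/β) - α²/(2β)`.

*Degree.* The last expression is at least `1 / 2` if `d ≥ 3α - 3β + 6` and `α ≤ 6β - 9`
(`IsAmplyRegular.curvatureGE_half`). The inequality on `d` follows by inclusion-exclusion from the
existence of a claw (`IsAmplyRegular.three_mul_add_six_le_of_claw`), and a claw exists as soon as
two vertices are at distance at least four (`IsAmplyRegular.exists_claw`). Without such vertices
the bound `4d` is immediate.
-/

open Finset

namespace SimpleGraph

variable {V : Type u} {G : SimpleGraph V} {n : ℕ∞} {d α β : ℕ}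

/-! ### Counting in neighbourhoods -/

section Counting

variable [G.LocallyFinite]

lemma IsAmplyRegular.card_neighborFinset (h : G.IsAmplyRegular n d α β) (v : V) :
    #(G.neighborFinset v) = d := by
  have := h.degree_eq v
  rw [← coe_neighborFinset, Set.encard_coe_eq_coe_finsetCard] at this
  exact_mod_cast this

variable [DecidableEq V]

lemma encard_commonNeighbors_eq (v w : V) :
    (G.commonNeighbors v w).encard = #(G.neighborFinset v ∩ G.neighborFinset w) := by
  rw [← Set.encard_coe_eq_coe_finsetCard, coe_inter, coe_neighborFinset, coe_neighborFinset,
    commonNeighbors_eq]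

lemma IsAmplyRegular.card_inter_of_adj (h : G.IsAmplyRegular n d α β) {v w : V}
    (hvw : G.Adj v w) : #(G.neighborFinset v ∩ G.neighborFinset w) = α := by
  have := h.of_adj v w hvw
  rw [encard_commonNeighbors_eq] at this
  exact_mod_cast this

lemma IsAmplyRegular.card_inter_of_adj_of_adj (h : G.IsAmplyRegular n d α β) {u v w : V}
    (huv : G.Adj u v) (huw : G.Adj u w) (hne : v ≠ w) (hvw : ¬ G.Adj v w) :
    #(G.neighborFinset v ∩ G.neighborFinset w) = β := by
  have hd : G.dist v w = 2 := by
    have : G.edist v w = 2 := edist_eq_two_iff.2 ⟨hne, hvw, u, by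
      simp [mem_commonNeighbors, huv.symm, huw.symm]⟩
    simp [dist, this]
  have := h.of_dist_eq_two v w hd
  rw [encard_commonNeighbors_eq] at this
  exact_mod_cast this

/-- For adjacent `u` and `v`, the neighbours of `u` other than `v` split into the `α` neighbours
of `v` and the `d - 1 - α` others. -/
lemma IsAmplyRegular.card_sdiff (h : G.IsAmplyRegular n d α β) {u v : V} (huv : G.Adj u v) :
    #(G.neighborFinset u \ insert v (G.neighborFinset u ∩ G.neighborFinset v)) + 1 + α = d := by
  have hsub : insert v (G.neighborFinset u ∩ G.neighborFinset v) ⊆ G.neighborFinset u :=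
    insert_subset (by simpa using huv) inter_subset_left
  have h1 := card_sdiff_add_card_eq_card hsub
  rw [card_insert_of_notMem (by simp), h.card_inter_of_adj huv, h.card_neighborFinset] at h1
  omega

/-- A claw forces a large degree: inside the neighbourhood of `u`, the three closed
neighbourhoods of the leaves have `α + 1` elements each and pairwise meet in at most `β - 1`. -/
lemma IsAmplyRegular.three_mul_add_six_le_of_claw (h : G.IsAmplyRegular n d α β) {u a b c : V}
    (ha : G.Adj u a) (hb : G.Adj u b) (hc : G.Adj u c) (hab : a ≠ b) (hac : a ≠ c) (hbc : b ≠ c)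
    (hab' : ¬ G.Adj a b) (hac' : ¬ G.Adj a c) (hbc' : ¬ G.Adj b c) :
    3 * α + 6 ≤ d + 3 * β := by
  let A : V → Finset V := fun v ↦ insert v (G.neighborFinset u ∩ G.neighborFinset v)
  have hcard {v : V} (hv : G.Adj u v) : #(A v) = α + 1 := by
    rw [card_insert_of_notMem (by simp), h.card_inter_of_adj hv]
  have hsub {v : V} (hv : G.Adj u v) : A v ⊆ G.neighborFinset u :=
    insert_subset (by simpa using hv) inter_subset_left
  have hinter {v w : V} (hv : G.Adj u v) (hw : G.Adj u w) (hne : v ≠ w) (hvw : ¬ G.Adj v w) :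
      #(A v ∩ A w) + 1 ≤ β := by
    have hu : u ∈ G.neighborFinset v ∩ G.neighborFinset w := by simp [hv.symm, hw.symm]
    rw [← h.card_inter_of_adj_of_adj hv hw hne hvw, ← card_erase_add_one hu]
    refine Nat.add_le_add_right (card_le_card fun z hz ↦ ?_) 1
    simp only [A, mem_inter, mem_insert, mem_neighborFinset, mem_erase] at hz ⊢
    have := G.adj_comm v w
    have := G.irrefl (v := u)
    grind
  have h1 := card_union_add_card_inter (A a) (A b)
  have h2 := card_union_add_card_inter (A a ∪ A b) (A c)
  have h3 : #((A a ∪ A b) ∩ A c) ≤ #(A a ∩ A c) + #(A b ∩ A c) := by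
    rw [union_inter_distrib_right]; exact card_union_le _ _
  have h4 : #(A a ∪ A b ∪ A c) ≤ d := by
    rw [← h.card_neighborFinset u]
    exact card_le_card (union_subset (union_subset (hsub ha) (hsub hb)) (hsub hc))
  rw [hcard ha, hcard hb] at h1
  rw [hcard hc] at h2
  have := hinter ha hb hab hab'
  have := hinter ha hc hac hac'
  have := hinter hb hc hbc hbc'
  omega

end Counting

/-! ### Claws on long geodesics -/

/-- Two vertices at distance at least `4` are the start of a geodesic of length `4`. -/
lemma Connected.exists_path_of_four_le_dist (hG : G.Connected) {u v : V} (huv : 4 ≤ G.dist u v) :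
    ∃ x₁ x₂ x₃ x₄, G.Adj u x₁ ∧ G.Adj x₁ x₂ ∧ G.Adj x₂ x₃ ∧ G.Adj x₃ x₄ ∧ 4 ≤ G.dist u x₄ := by
  obtain ⟨p, hp⟩ := hG.exists_walk_length_eq_dist u v
  match p, hp with
  | .nil, hp => simp at huv
  | .cons _ .nil, hp => simp at hp; omega
  | .cons _ (.cons _ .nil), hp => simp at hp; omega
  | .cons _ (.cons _ (.cons _ .nil)), hp => simp at hp; omega
  | .cons (v := x₁) h₁ (.cons (v := x₂) h₂ (.cons (v := x₃) h₃ (.cons (v := x₄) h₄ q))), hp =>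
    refine ⟨x₁, x₂, x₃, x₄, h₁, h₂, h₃, h₄, ?_⟩
    have := hG.dist_triangle (u := u) (v := x₄) (w := v)
    have := dist_le q
    simp only [Walk.length_cons] at hp
    omega

/-- With `β ≥ 2`, a geodesic `x₀ x₁ x₂ x₃ x₄` yields a claw. Otherwise a second common neighbour
`p` of `x₁` and `x₃` is adjacent to `x₂`, and every neighbour of `x₂` not adjacent to `p` is
adjacent to `x₀` or to `x₄`; all of them are adjacent to the same one of these two. So there are
at most `β - 1` of them, whereas the equally many neighbours of `x₂` not adjacent to `x₃` include
the `β` common neighbours of `x₀` and `x₂`. -/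
lemma IsAmplyRegular.exists_claw (h : G.IsAmplyRegular n d α β) (hG : G.Connected) (hβ : 2 ≤ β)
    {u v : V} (huv : 4 ≤ G.dist u v) :
    ∃ w a b c, G.Adj w a ∧ G.Adj w b ∧ G.Adj w c ∧ a ≠ b ∧ a ≠ c ∧ b ≠ c ∧
      ¬ G.Adj a b ∧ ¬ G.Adj a c ∧ ¬ G.Adj b c := by
  classical
  have : G.LocallyFinite := fun v ↦
    (Set.finite_of_encard_eq_coe (h.degree_eq v)).fintype
  by_contra! H
  obtain ⟨x₁, x₂, x₃, x₄, h₁, h₂, h₃, h₄, hd⟩ := hG.exists_path_of_four_le_dist huv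
  generalize hx₀ : u = x₀ at *
  have hL {a b : V} (hab : G.Adj a b) : G.dist x₀ b ≤ G.dist x₀ a + 1 := by
    have := hG.dist_triangle (u := x₀) (v := a) (w := b)
    rwa [dist_eq_one_iff_adj.2 hab] at this
  have hL₀ : G.dist x₀ x₀ = 0 := dist_self
  have l₁ := hL h₁
  have l₂ := hL h₂
  have l₃ := hL h₃
  have l₄ := hL h₄
  have n13 : x₁ ≠ x₃ := by rintro rfl; omega
  have a13 : ¬ G.Adj x₁ x₃ := fun h ↦ by have := hL h; omega
  have n02 : x₀ ≠ x₂ := by rintro rfl; omega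
  have a02 : ¬ G.Adj x₀ x₂ := fun h ↦ by have := hL h; omega
  have n24 : x₂ ≠ x₄ := by rintro rfl; omega
  have a24 : ¬ G.Adj x₂ x₄ := fun h ↦ by have := hL h; omega
  obtain ⟨p, hp, hpx⟩ : ∃ p ∈ G.neighborFinset x₁ ∩ G.neighborFinset x₃, p ≠ x₂ :=
    exists_mem_ne (by rw [h.card_inter_of_adj_of_adj h₂.symm h₃ n13 a13]; omega) _
  simp only [mem_inter, mem_neighborFinset] at hp
  obtain ⟨p₁, p₃⟩ := hp
  have lp := hL p₁
  have lp' := hL p₃.symm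
  have n4p : x₄ ≠ p := by rintro rfl; omega
  have a4p : ¬ G.Adj x₄ p := fun h ↦ by have := hL h.symm; omega
  have n0p : x₀ ≠ p := by rintro rfl; omega
  have a0p : ¬ G.Adj x₀ p := fun h ↦ by have := hL h; omega
  have p₂ : G.Adj x₂ p := by
    by_contra hcon
    exact a4p (H x₃ x₂ x₄ p h₃.symm h₄ p₃ n24 hpx.symm n4p a24 hcon)
  have key {s : V} (hs : G.Adj x₂ s) (hsp : s ≠ p) (hsp' : ¬ G.Adj s p) :
      G.Adj x₀ s ∨ G.Adj x₄ s := by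
    by_contra! hcon
    have s₁ : ¬ G.Adj x₁ s := fun h ↦
      hsp' (H x₁ x₀ s p h₁.symm h p₁ (by rintro rfl; exact a02 hs.symm) n0p hsp hcon.1 a0p)
    have s₃ : ¬ G.Adj x₃ s := fun h ↦
      hsp' (H x₃ x₄ s p h₄ h p₃ (by rintro rfl; exact a24 hs) n4p hsp hcon.2 a4p)
    exact s₃ (H x₂ x₁ x₃ s h₂.symm h₃ hs n13 (by rintro rfl; exact hsp' p₁)
      (by rintro rfl; exact hsp' p₃) a13 s₁)
  have cp := h.card_sdiff p₂
  have c3 := h.card_sdiff h₃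
  set T := G.neighborFinset x₂ \ insert p (G.neighborFinset x₂ ∩ G.neighborFinset p) with hT
  have hmem {s : V} : s ∈ T ↔ G.Adj x₂ s ∧ s ≠ p ∧ ¬ G.Adj s p := by
    simp only [hT, mem_sdiff, mem_neighborFinset, mem_insert, mem_inter, G.adj_comm s p]
    tauto
  have c02 := h.card_inter_of_adj_of_adj h₁.symm h₂ n02 a02
  have c24 := h.card_inter_of_adj_of_adj h₃.symm h₄ n24 a24
  have hTβ : #T + 1 ≤ β := by
    by_cases hT0 : ∃ s ∈ T, G.Adj x₀ s
    · obtain ⟨s, hs, hs0⟩ := hT0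
      obtain ⟨hs2, hsp, hsp'⟩ := hmem.1 hs
      rw [← c02, ← card_erase_add_one (s := G.neighborFinset x₀ ∩ _) (a := x₁)
        (by simp [h₁, h₂.symm])]
      refine Nat.add_le_add_right (card_le_card fun t ht ↦ ?_) 1
      obtain ⟨ht2, htp, htp'⟩ := hmem.1 ht
      have ht0 : G.Adj x₀ t := by
        refine (key ht2 htp htp').resolve_right fun ht4 ↦ ?_
        have e1 := hL hs0
        have e2 := hL ht4.symm
        refine htp' (H x₂ s t p hs2 ht2 p₂ ?_ hsp htp ?_ hsp')
        · rintro rfl; omega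
        · intro hst; have := hL hst; omega
      simp only [mem_erase, mem_inter, mem_neighborFinset]
      exact ⟨by rintro rfl; exact htp' p₁, ht0, ht2⟩
    · rw [← c24, ← card_erase_add_one (s := G.neighborFinset x₂ ∩ _) (a := x₃)
        (by simp [h₃, h₄.symm])]
      refine Nat.add_le_add_right (card_le_card fun t ht ↦ ?_) 1
      obtain ⟨ht2, htp, htp'⟩ := hmem.1 ht
      have ht4 := (key ht2 htp htp').resolve_left fun ht0 ↦ hT0 ⟨t, ht, ht0⟩
      simp only [mem_erase, mem_inter, mem_neighborFinset]
      exact ⟨by rintro rfl; exact htp' p₃, ht2, ht4⟩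
  have hβU : β ≤ #(G.neighborFinset x₂ \
      insert x₃ (G.neighborFinset x₂ ∩ G.neighborFinset x₃)) := by
    rw [← c02]
    refine card_le_card fun s hs ↦ ?_
    simp only [mem_inter, mem_neighborFinset] at hs
    have e1 := hL hs.1
    simp only [mem_sdiff, mem_neighborFinset, mem_insert, mem_inter, not_or, not_and]
    refine ⟨hs.2, by rintro rfl; omega, fun _ h ↦ ?_⟩
    have := hL h.symm
    omega
  omega

/-! ### Curvature-dimension inequality and diameter -/

lemma Walk.abs_sub_le {f : V → ℝ} {c : ℝ} (hc : ∀ x y, G.Adj x y → |f y - f x| ≤ c) {u v : V}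
    (p : G.Walk u v) : |f v - f u| ≤ p.length * c := by
  induction p with
  | nil => simp
  | @cons u v w h p ih =>
    have := _root_.abs_sub_le (f w) (f v) (f u)
    have := hc _ _ h
    rw [Walk.length_cons]
    push_cast
    linarith

section Curvature

variable [G.LocallyFinite]

variable (G) in
/-- The graph Laplacian `Δ f`, with the sign for which `Δ f x` sums the increments of `f` along
the edges leaving `x`. -/
noncomputable def lap (f : V → ℝ) (x : V) : ℝ := ∑ y ∈ G.neighborFinset x, (f y - f x)

variable (G) in
/-- The squared gradient `∑ (f y - f x) ^ 2` over the neighbours `y` of `x`, that is, twice the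
carré du champ `Γ f x`. -/
noncomputable def energy (f : V → ℝ) (x : V) : ℝ := ∑ y ∈ G.neighborFinset x, (f y - f x) ^ 2

variable (G) in
/-- The Bakry–Émery curvature-dimension inequality `CD(κ, ∞)` for the non-normalised Laplacian:
`Γ₂ f ≥ κ Γ f`, where `2 Γ₂ f = Δ Γ f - 2 Γ (f, Δ f)`. Both sides are doubled, and `Γ f` is
written as half of `energy`. -/
def CurvatureGE (κ : ℝ) : Prop :=
  ∀ (f : V → ℝ) (x : V), κ * G.energy f x ≤ G.lap (G.energy f) x / 2 -
    ∑ y ∈ G.neighborFinset x, (f y - f x) * (G.lap f y - G.lap f x)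

lemma sq_sub_le_energy {f : V → ℝ} {x y : V} (h : G.Adj x y) : (f y - f x) ^ 2 ≤ G.energy f x :=
  single_le_sum (f := fun y ↦ (f y - f x) ^ 2) (fun _ _ ↦ sq_nonneg _) (by simpa using h)

lemma sq_lap_le (hd : ∀ v, #(G.neighborFinset v) = d) (f : V → ℝ) (x : V) :
    G.lap f x ^ 2 ≤ d * G.energy f x := by
  rw [← hd x]
  exact sq_sum_le_card_mul_sum_sq

lemma energy_lap_le (hd : ∀ v, #(G.neighborFinset v) = d) {f : V → ℝ} {g : ℝ}
    (hg : ∀ x, G.energy f x ≤ g) (x : V) : G.energy (G.lap f) x ≤ 4 * d ^ 2 * g := by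
  have hl (y : V) : G.lap f y ^ 2 ≤ d * g :=
    (sq_lap_le hd f y).trans (mul_le_mul_of_nonneg_left (hg y) (Nat.cast_nonneg _))
  calc G.energy (G.lap f) x ≤ ∑ _y ∈ G.neighborFinset x, 4 * (d * g) := by
        refine sum_le_sum fun y _ ↦ ?_
        nlinarith [hl x, hl y, sq_nonneg (G.lap f y + G.lap f x)]
    _ = 4 * d ^ 2 * g := by rw [sum_const, hd, nsmul_eq_mul]; ring

/-- One explicit Euler step of the heat flow contracts the supremum of the squared gradient. -/
lemma CurvatureGE.energy_step_le {κ ε g : ℝ} (hκ : G.CurvatureGE κ)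
    (hd : ∀ v, #(G.neighborFinset v) = d) (hε : 0 ≤ ε) (hε' : ε * (d + 2 * κ) ≤ 1) {f : V → ℝ}
    (hg : ∀ x, G.energy f x ≤ g) (x : V) :
    G.energy (fun y ↦ f y + ε * G.lap f y) x ≤ (1 - 2 * κ * ε + 4 * d ^ 2 * ε ^ 2) * g := by
  have hexp : G.energy (fun y ↦ f y + ε * G.lap f y) x = G.energy f x +
      2 * ε * ∑ y ∈ G.neighborFinset x, (f y - f x) * (G.lap f y - G.lap f x) +
      ε ^ 2 * G.energy (G.lap f) x := by
    simp only [energy, mul_sum, ← sum_add_distrib]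
    exact sum_congr rfl fun y _ ↦ by ring
  have hlap : G.lap (G.energy f) x ≤ d * g - d * G.energy f x := by
    rw [lap, sum_sub_distrib, sum_const, hd, nsmul_eq_mul]
    refine sub_le_sub_right ?_ _
    calc _ ≤ ∑ _y ∈ G.neighborFinset x, g := sum_le_sum fun y _ ↦ hg y
      _ = d * g := by rw [sum_const, hd, nsmul_eq_mul]
  have h1 := mul_le_mul_of_nonneg_left (hκ f x) (by positivity : 0 ≤ 2 * ε)
  have h2 := mul_le_mul_of_nonneg_left (energy_lap_le hd hg x) (sq_nonneg ε)
  have h3 := mul_le_mul_of_nonneg_left hlap hε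
  have h4 := mul_le_mul_of_nonneg_left (hg x) (sub_nonneg.2 hε')
  rw [hexp]
  linarith

/-- A discrete Bonnet–Myers theorem. The Euler scheme for the heat flow started at the distance
function from `u` flattens this function in the limit, and moves each of its values by at most
`d / κ'`, for every `κ' < κ`, provided the step is small enough. -/
theorem CurvatureGE.mul_dist_le {κ : ℝ} (hκ : G.CurvatureGE κ)
    (hd : ∀ v, #(G.neighborFinset v) = d) (hG : G.Connected) (hκ0 : 0 < κ) (u v : V) :
    κ * G.dist u v ≤ 2 * d := by
  by_contra! hcon
  set l : ℝ := ((G.dist u v : ℕ) : ℝ) with hl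
  have hl0 : 0 < l := by
    refine (Nat.cast_nonneg _).lt_of_ne fun h0 ↦ ?_
    rw [← hl] at h0
    rw [← h0, mul_zero] at hcon
    have : (0 : ℝ) ≤ 2 * d := by positivity
    linarith
  obtain ⟨κ', h1, h2⟩ := exists_between ((div_lt_iff₀ hl0).2 hcon)
  have hκ'0 : 0 < κ' := lt_of_le_of_lt (by positivity) h1
  rw [div_lt_iff₀ hl0] at h1
  refine absurd h1 (not_lt.2 ?_)
  -- The second bound on the step makes the contraction factor at most `(1 - κ' * ε) ^ 2`.
  obtain ⟨ε, hε0, hε1, hε2⟩ :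
      ∃ ε : ℝ, 0 < ε ∧ ε * (d + 2 * κ) ≤ 1 ∧ ε * (2 * d ^ 2 + 1) ≤ κ - κ' := by
    refine ⟨min (1 / (d + 2 * κ)) ((κ - κ') / (2 * d ^ 2 + 1)), ?_, ?_, ?_⟩
    · have := sub_pos.2 h2
      positivity
    · rw [← le_div_iff₀ (by positivity)]
      exact min_le_left _ _
    · rw [← le_div_iff₀ (by positivity)]
      exact min_le_right _ _
  set ρ : ℝ := 1 - κ' * ε with hρ
  have hρ1 : ρ < 1 := by have := mul_pos hκ'0 hε0; linarith
  have hρ0 : 0 ≤ ρ := by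
    have := mul_lt_mul_of_pos_right h2 hε0
    have : 0 ≤ ε * d := by positivity
    have := mul_pos hκ0 hε0
    linarith
  let F : ℕ → V → ℝ := fun k ↦ (fun f y ↦ f y + ε * G.lap f y)^[k] fun y ↦ (G.dist u y : ℝ)
  have hF0 (y : V) : F 0 y = G.dist u y := rfl
  have hFs (k : ℕ) : F (k + 1) = fun y ↦ F k y + ε * G.lap (F k) y :=
    Function.iterate_succ_apply' _ _ _
  have hE (k : ℕ) : ∀ x, G.energy (F k) x ≤ d * (ρ ^ k) ^ 2 := by
    induction k with
    | zero =>
      intro x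
      calc G.energy (F 0) x ≤ ∑ _y ∈ G.neighborFinset x, (1 : ℝ) := by
            refine sum_le_sum fun y hy ↦ ?_
            rw [mem_neighborFinset] at hy
            have e1 := hG.dist_triangle (u := u) (v := x) (w := y)
            have e2 := hG.dist_triangle (u := u) (v := y) (w := x)
            rw [dist_eq_one_iff_adj.2 hy] at e1
            rw [dist_eq_one_iff_adj.2 hy.symm] at e2
            rw [hF0, hF0, sq_le_one_iff_abs_le_one, abs_le]
            have e1' : (G.dist u y : ℝ) ≤ G.dist u x + 1 := by exact_mod_cast e1
            have e2' : (G.dist u x : ℝ) ≤ G.dist u y + 1 := by exact_mod_cast e2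
            constructor <;> linarith
        _ = d * (ρ ^ 0) ^ 2 := by simp only [sum_const, hd, nsmul_eq_mul, pow_zero, one_pow]
    | succ k ih =>
      intro x
      rw [hFs]
      refine (hκ.energy_step_le hd hε0.le hε1 ih x).trans ?_
      have hfac : 1 - 2 * κ * ε + 4 * d ^ 2 * ε ^ 2 ≤ ρ ^ 2 := by
        have := mul_le_mul_of_nonneg_left hε2 hε0.le
        nlinarith [sq_nonneg (κ' * ε), sq_nonneg ε]
      calc _ ≤ ρ ^ 2 * (d * (ρ ^ k) ^ 2) := mul_le_mul_of_nonneg_right hfac (by positivity)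
        _ = d * (ρ ^ (k + 1)) ^ 2 := by ring
  have hlap (k : ℕ) (x : V) : |G.lap (F k) x| ≤ d * ρ ^ k := by
    refine abs_le_of_sq_le_sq ((sq_lap_le hd _ x).trans ?_) (by positivity)
    calc _ ≤ (d : ℝ) * (d * (ρ ^ k) ^ 2) := mul_le_mul_of_nonneg_left (hE k x) (by positivity)
      _ = (d * ρ ^ k) ^ 2 := by ring
  have hmove (k : ℕ) (x : V) : κ' * |F k x - F 0 x| ≤ d * (1 - ρ ^ k) := by
    induction k with
    | zero => simp
    | succ k ih =>
      have e1 : |F (k + 1) x - F 0 x| ≤ ε * |G.lap (F k) x| + |F k x - F 0 x| := by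
        have : F (k + 1) x - F 0 x = ε * G.lap (F k) x + (F k x - F 0 x) := by rw [hFs]; ring
        rw [this, ← abs_of_pos hε0, ← abs_mul, abs_of_pos hε0]
        exact abs_add_le _ _
      have e2 := mul_le_mul_of_nonneg_left e1 hκ'0.le
      have e3 := mul_le_mul_of_nonneg_left (hlap k x) (mul_pos hκ'0 hε0).le
      have e4 : (d : ℝ) * ρ ^ (k + 1) = d * ρ ^ k - κ' * ε * (d * ρ ^ k) := by
        rw [pow_succ, hρ]; ring
      linarith
  have hflat (k : ℕ) : |F k v - F k u| ≤ l * (d * ρ ^ k) := by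
    obtain ⟨p, hp⟩ := hG.exists_walk_length_eq_dist u v
    rw [hl, ← hp]
    refine p.abs_sub_le (fun x y hxy ↦ abs_le_of_sq_le_sq ?_ (by positivity))
    refine (sq_sub_le_energy hxy).trans ((hE k x).trans ?_)
    have : (d : ℝ) ≤ d ^ 2 := by exact_mod_cast Nat.le_self_pow two_ne_zero d
    rw [mul_pow]
    exact mul_le_mul_of_nonneg_right this (by positivity)
  have hbound (k : ℕ) : κ' * l ≤ 2 * d + κ' * (l * d) * ρ ^ k := by
    have e0 : l = F 0 v - F 0 u := by rw [hF0, hF0, dist_self]; simp [hl]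
    have e1 := hmove k v
    have e2 := hmove k u
    have e3 := neg_abs_le (F k v - F 0 v)
    have e4 := le_abs_self (F k u - F 0 u)
    have e5 := (le_abs_self _).trans (hflat k)
    have e6 : l ≤ |F k v - F 0 v| + |F k u - F 0 u| + l * (d * ρ ^ k) := by linarith
    have e7 := mul_le_mul_of_nonneg_left e6 hκ'0.le
    have e8 : 0 ≤ d * ρ ^ k := by positivity
    linarith
  have hlim : Filter.Tendsto (fun k ↦ 2 * d + κ' * (l * d) * ρ ^ k) Filter.atTop
      (nhds (2 * d + κ' * (l * d) * 0)) :=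
    ((tendsto_pow_atTop_nhds_zero_of_lt_one hρ0 hρ1).const_mul _).const_add _
  simpa using ge_of_tendsto' hlim hbound

end Curvature

/-! ### Curvature of amply regular graphs -/

section Bochner

variable [G.LocallyFinite]

/-- Bochner's formula for `2 Γ₂ f x`, with the terms along paths `x, y, z` completed to squares. -/
lemma gamma_two_eq (hd : ∀ v, #(G.neighborFinset v) = d) (f : V → ℝ) (x : V) :
    G.lap (G.energy f) x / 2 -
        ∑ y ∈ G.neighborFinset x, (f y - f x) * (G.lap f y - G.lap f x) =
      (∑ y ∈ G.neighborFinset x, ∑ z ∈ G.neighborFinset y,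
        ((f z - f x) - 2 * (f y - f x)) ^ 2) / 2 -
      d * ∑ y ∈ G.neighborFinset x, (f y - f x) ^ 2 +
      (∑ y ∈ G.neighborFinset x, (f y - f x)) ^ 2 := by
  have h1 (y : V) : ∑ z ∈ G.neighborFinset y, ((f z - f x) - 2 * (f y - f x)) ^ 2 =
      G.energy f y - 2 * (f y - f x) * G.lap f y + d * (f y - f x) ^ 2 := by
    have : (d : ℝ) * (f y - f x) ^ 2 = ∑ z ∈ G.neighborFinset y, (f y - f x) ^ 2 := by
      rw [sum_const, hd, nsmul_eq_mul]
    rw [this]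
    simp only [energy, lap, mul_sum, ← sum_add_distrib, ← sum_sub_distrib]
    exact sum_congr rfl fun z _ ↦ by ring
  have h2 : G.lap (G.energy f) x = ∑ y ∈ G.neighborFinset x, G.energy f y - d * G.energy f x := by
    rw [lap, sum_sub_distrib, sum_const, hd, nsmul_eq_mul]
  have h3 : ∑ y ∈ G.neighborFinset x, (f y - f x) * (G.lap f y - G.lap f x) =
      ∑ y ∈ G.neighborFinset x, (f y - f x) * G.lap f y -
        (∑ y ∈ G.neighborFinset x, (f y - f x)) ^ 2 := by
    rw [sq]
    rw [sum_mul, ← sum_sub_distrib]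
    exact sum_congr rfl fun y _ ↦ by rw [lap.eq_1 G f x]; ring
  have h4 : ∑ y ∈ G.neighborFinset x, 2 * (f y - f x) * G.lap f y =
      2 * ∑ y ∈ G.neighborFinset x, (f y - f x) * G.lap f y := by
    rw [mul_sum]; exact sum_congr rfl fun y _ ↦ by ring
  simp only [h1, sum_add_distrib, sum_sub_distrib, ← mul_sum, h2, h3, h4]
  rw [energy.eq_1 G f x]
  ring

variable [DecidableEq V]

/-- Summing over paths `x, y, z` of length two, ordered by their end `z`. Any `T` that contains
all the ends will do. -/
lemma sum_neighborFinset_comm {x : V} {T : Finset V}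
    (hT : ((G.neighborFinset x).biUnion fun y ↦ G.neighborFinset y) ⊆ T) (F : V → V → ℝ) :
    ∑ y ∈ G.neighborFinset x, ∑ z ∈ G.neighborFinset y, F y z =
      ∑ z ∈ T, ∑ y ∈ G.neighborFinset x ∩ G.neighborFinset z, F y z := by
  refine sum_comm' fun y z ↦ ?_
  simp only [mem_inter, mem_neighborFinset, G.adj_comm z y]
  refine ⟨fun h ↦ ⟨h, hT ?_⟩, fun h ↦ h.1⟩
  simp only [mem_biUnion, mem_neighborFinset]
  exact ⟨y, h⟩

/-- In a neighbourhood, which is `α`-regular, the local adjacency operator multiplies the sum of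
a function by `α`. -/
lemma IsAmplyRegular.sum_sum_inter (h : G.IsAmplyRegular n d α β) (x : V) (g : V → ℝ) :
    ∑ y ∈ G.neighborFinset x, ∑ z ∈ G.neighborFinset x ∩ G.neighborFinset y, g z =
      α * ∑ z ∈ G.neighborFinset x, g z := by
  rw [sum_comm' (t' := G.neighborFinset x) (s' := fun z ↦ G.neighborFinset x ∩ G.neighborFinset z)
    (fun y z ↦ by simp only [mem_inter, mem_neighborFinset, G.adj_comm z y]; tauto), mul_sum]
  refine sum_congr rfl fun z hz ↦ ?_
  rw [sum_const, h.card_inter_of_adj (by simpa using hz), nsmul_eq_mul]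

/-- The sums of `g` over the sets of common neighbours of `x` and `z`, squared and summed over
all `z`, as a quadratic form on the neighbourhood of `x`: the number of `z` adjacent to both of
`y` and `y'` is `d`, `α` or `β`, if `y` and `y'` are equal, adjacent or neither. -/
lemma IsAmplyRegular.sum_sq_sum_inter (h : G.IsAmplyRegular n d α β) {x : V} {T : Finset V}
    (hT : ((G.neighborFinset x).biUnion fun y ↦ G.neighborFinset y) ⊆ T) (g : V → ℝ) :
    ∑ z ∈ T, (∑ y ∈ G.neighborFinset x ∩ G.neighborFinset z, g y) ^ 2 =
      (d - β) * ∑ y ∈ G.neighborFinset x, g y ^ 2 +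
      (α - β) * ∑ y ∈ G.neighborFinset x,
        g y * ∑ z ∈ G.neighborFinset x ∩ G.neighborFinset y, g z +
      β * (∑ y ∈ G.neighborFinset x, g y) ^ 2 := by
  have h1 : ∑ z ∈ T, (∑ y ∈ G.neighborFinset x ∩ G.neighborFinset z, g y) ^ 2 =
      ∑ y ∈ G.neighborFinset x, ∑ z ∈ G.neighborFinset y,
        g y * ∑ y' ∈ G.neighborFinset x ∩ G.neighborFinset z, g y' := by
    rw [sum_neighborFinset_comm hT]
    exact sum_congr rfl fun z _ ↦ by rw [sq, sum_mul]
  have h2 {y : V} (hy : G.Adj x y) : ∑ z ∈ G.neighborFinset y,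
      ∑ y' ∈ G.neighborFinset x ∩ G.neighborFinset z, g y' =
      (d - β) * g y + (α - β) * ∑ z ∈ G.neighborFinset x ∩ G.neighborFinset y, g z +
        β * ∑ y' ∈ G.neighborFinset x, g y' := by
    have hcount : ∀ y' ∈ G.neighborFinset x,
        (#(G.neighborFinset y ∩ G.neighborFinset y') : ℝ) * g y' =
          (if y = y' then (d - β) * g y' else 0) +
          (if y' ∈ G.neighborFinset y then (α - β) * g y' else 0) + β * g y' := by
      intro y' hy'
      by_cases he : y = y'
      · subst he
        rw [inter_self, h.card_neighborFinset, if_pos rfl, if_neg (by simp)]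
        ring
      · by_cases ha : G.Adj y y'
        · rw [h.card_inter_of_adj ha, if_neg he, if_pos (by simpa using ha)]; ring
        · rw [h.card_inter_of_adj_of_adj hy (by simpa using hy') he ha, if_neg he,
            if_neg (by simpa using ha)]
          ring
    rw [sum_comm' (t' := G.neighborFinset x)
      (s' := fun y' ↦ G.neighborFinset y ∩ G.neighborFinset y') (fun z y' ↦ by
        simp only [mem_inter, mem_neighborFinset, G.adj_comm z y']; tauto)]
    simp only [sum_const, nsmul_eq_mul]
    rw [sum_congr rfl hcount, sum_add_distrib, sum_add_distrib, sum_ite_eq,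
      if_pos (by simpa using hy), ← sum_filter, filter_mem_eq_inter, ← mul_sum, ← mul_sum]
  rw [h1, sq, sum_mul]
  rw [mul_sum, mul_sum, mul_sum, ← sum_add_distrib, ← sum_add_distrib]
  refine sum_congr rfl fun y hy ↦ ?_
  rw [← mul_sum, h2 (by simpa using hy)]
  ring

/-- A lower bound for `2 Γ₂` by a quadratic form on the neighbourhood of `x`, obtained by
minimising over the values of `f` at distance two from `x`. -/
lemma IsAmplyRegular.le_gamma_two (h : G.IsAmplyRegular n d α β) (hβ : 0 < β) (f : V → ℝ)
    (x : V) {g S : V → ℝ} (hg : ∀ y, g y = f y - f x)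
    (hS : ∀ y, S y = ∑ z ∈ G.neighborFinset x ∩ G.neighborFinset y, g z) :
    (d - 2 * d / β + 2 + α / 2) * ∑ y ∈ G.neighborFinset x, g y ^ 2 -
      2 * α / β * ∑ y ∈ G.neighborFinset x, g y * S y +
      2 / β * ∑ y ∈ G.neighborFinset x, S y ^ 2 -
      (1 - 2 / β) * (∑ y ∈ G.neighborFinset x, g y) ^ 2 ≤
    G.lap (G.energy f) x / 2 -
      ∑ y ∈ G.neighborFinset x, (f y - f x) * (G.lap f y - G.lap f x) := by
  have hβ' : (0 : ℝ) < β := by exact_mod_cast hβ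
  rw [gamma_two_eq h.card_neighborFinset]
  simp only [← hg]
  have gx : g x = 0 := by rw [hg, sub_self]
  set N := G.neighborFinset x with hN
  set T := insert x (N ∪ N.biUnion fun y ↦ G.neighborFinset y) with hT
  have hsub : (N.biUnion fun y ↦ G.neighborFinset y) ⊆ T :=
    subset_union_right.trans (subset_insert _ _)
  have hsq := h.sum_sq_sum_inter hsub g
  simp only [← hN, ← hS] at hsq
  have hdiag : ∑ z ∈ T, ∑ y ∈ N ∩ G.neighborFinset z, g y ^ 2 = d * ∑ y ∈ N, g y ^ 2 := by
    rw [← sum_neighborFinset_comm hsub (fun y _ ↦ g y ^ 2), mul_sum]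
    exact sum_congr rfl fun y _ ↦ by rw [sum_const, h.card_neighborFinset, nsmul_eq_mul]
  have Sx : S x = ∑ y ∈ N, g y := by rw [hS, inter_self]
  -- Equality holds at `z = x` and for `z` adjacent to `x`. At distance two from `x`, the right-hand
  -- side is quadratic in `g z` with leading coefficient `β`, and the left-hand side is its minimum.
  have hterm : ∀ z ∈ T, 4 * ∑ y ∈ N ∩ G.neighborFinset z, g y ^ 2 - 4 / β * S z ^ 2 +
      (if z = x then 4 / β * S z ^ 2 else 0) +
      (if z ∈ N then α * g z ^ 2 - 4 * (g z * S z) + 4 / β * S z ^ 2 else 0) ≤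
      ∑ y ∈ N ∩ G.neighborFinset z, (g z - 2 * g y) ^ 2 := by
    intro z hz
    have hexp : ∑ y ∈ N ∩ G.neighborFinset z, (g z - 2 * g y) ^ 2 =
        #(N ∩ G.neighborFinset z) * g z ^ 2 - 4 * (g z * S z) +
          4 * ∑ y ∈ N ∩ G.neighborFinset z, g y ^ 2 := by
      rw [hS, ← nsmul_eq_mul, ← sum_const, mul_sum, mul_sum, mul_sum, ← sum_sub_distrib,
        ← sum_add_distrib]
      exact sum_congr rfl fun y _ ↦ by ring
    rw [hexp]
    by_cases hzx : z = x
    · subst hzx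
      rw [if_pos rfl, if_neg (by simp [hN]), gx]
      linarith
    by_cases hzN : z ∈ N
    · rw [if_neg hzx, if_pos hzN, h.card_inter_of_adj (by simpa [hN] using hzN)]
      linarith
    · have hz' : z ∈ N.biUnion fun y ↦ G.neighborFinset y := by
        simpa [hT, hzx, hzN] using hz
      obtain ⟨y, hy, hyz⟩ := mem_biUnion.1 hz'
      rw [hN, mem_neighborFinset] at hy hzN
      rw [mem_neighborFinset] at hyz
      rw [if_neg hzx, if_neg (by simpa [hN] using hzN),
        h.card_inter_of_adj_of_adj hy.symm hyz (Ne.symm hzx) hzN]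
      have : (0 : ℝ) ≤ (β * g z - 2 * S z) ^ 2 / β := by positivity
      have e : (β * g z - 2 * S z) ^ 2 / β = β * g z ^ 2 - 4 * (g z * S z) + 4 / β * S z ^ 2 := by
        field_simp
        ring
      linarith
  have hsum := sum_le_sum hterm
  have hNT : {z ∈ T | z ∈ N} = N := by
    ext z
    simp only [mem_filter, hT, mem_insert, mem_union]
    tauto
  rw [← sum_neighborFinset_comm hsub (fun y z ↦ (g z - 2 * g y) ^ 2), sum_add_distrib,
    sum_add_distrib, sum_sub_distrib, ← mul_sum, ← mul_sum, hdiag, hsq, sum_ite_eq',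
    if_pos (mem_insert_self _ _), ← sum_filter, hNT, sum_add_distrib, sum_sub_distrib,
    ← mul_sum, ← mul_sum, ← mul_sum, Sx] at hsum
  refine le_trans (le_of_eq ?_) (add_le_add_left (sub_le_sub_right
    (div_le_div_of_nonneg_right hsum zero_le_two) _) _)
  field_simp
  ring

/-- The curvature of an amply regular graph. The local adjacency operator `A` enters through
`A² - αA`, which is at least `-α²/4` by completing the square. -/
theorem IsAmplyRegular.curvatureGE (h : G.IsAmplyRegular n d α β) (hd : 0 < d) (hβ : 0 < β)
    {κ : ℝ} (hκ : κ ≤ 2)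
    (hκ' : 2 * β * κ ≤ 4 * β + α * β - α ^ 2 + 2 * d * (β - 2)) : G.CurvatureGE κ := by
  intro f x
  have hβ' : (0 : ℝ) < β := by exact_mod_cast hβ
  have hd' : (0 : ℝ) < d := by exact_mod_cast hd
  refine le_trans ?_ (h.le_gamma_two hβ f x (fun _ ↦ rfl) fun _ ↦ rfl)
  set g : V → ℝ := fun y ↦ f y - f x
  set S : V → ℝ := fun y ↦ ∑ z ∈ G.neighborFinset x ∩ G.neighborFinset y, g z
  change κ * ∑ y ∈ G.neighborFinset x, g y ^ 2 ≤ _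
  have hSsum : ∑ y ∈ G.neighborFinset x, S y = α * ∑ y ∈ G.neighborFinset x, g y :=
    h.sum_sum_inter x g
  set s := ∑ y ∈ G.neighborFinset x, g y with hs
  have hcs : s ^ 2 ≤ d * ∑ y ∈ G.neighborFinset x, g y ^ 2 := by
    rw [← h.card_neighborFinset x]
    exact sq_sum_le_card_mul_sum_sq
  -- The square is completed on the orthogonal complement of the constants, hence the mean `s / d`.
  have hsos : 0 ≤ ∑ y ∈ G.neighborFinset x, S y ^ 2 - α * ∑ y ∈ G.neighborFinset x, g y * S y +
      α ^ 2 / 4 * ∑ y ∈ G.neighborFinset x, g y ^ 2 - α ^ 2 / (4 * d) * s ^ 2 := by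
    have h0 : 0 ≤ ∑ y ∈ G.neighborFinset x, (S y - α / 2 * g y - α / 2 * (s / d)) ^ 2 :=
      sum_nonneg fun _ _ ↦ sq_nonneg _
    have e (y : V) : (S y - α / 2 * g y - α / 2 * (s / d)) ^ 2 =
        S y ^ 2 - α * (g y * S y) + α ^ 2 / 4 * g y ^ 2 - α * (s / d) * S y +
          α ^ 2 / 2 * (s / d) * g y + α ^ 2 / 4 * (s / d) ^ 2 := by ring
    simp only [e, sum_add_distrib, sum_sub_distrib, ← mul_sum, sum_const,
      h.card_neighborFinset, nsmul_eq_mul, hSsum, ← hs] at h0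
    refine h0.trans_eq ?_
    field_simp
    ring
  have ha : 0 ≤ ∑ y ∈ G.neighborFinset x, g y ^ 2 := sum_nonneg fun _ _ ↦ sq_nonneg _
  generalize ∑ y ∈ G.neighborFinset x, g y ^ 2 = a at *
  generalize ∑ y ∈ G.neighborFinset x, g y * S y = b at *
  generalize ∑ y ∈ G.neighborFinset x, S y ^ 2 = c at *
  have hβinv : (0 : ℝ) ≤ 2 / β := by positivity
  have h1 := mul_nonneg hβinv hsos
  set t : ℝ := α ^ 2 / (2 * β * d) - (1 - 2 / β) with ht
  have h2 : (2 + α / 2 - d * t) * a + t * s ^ 2 ≤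
      (d - 2 * d / β + 2 + α / 2) * a - 2 * α / β * b + 2 / β * c - (1 - 2 / β) * s ^ 2 := by
    rw [← sub_nonneg]
    refine h1.trans_eq ?_
    rw [ht]
    field_simp
    ring
  refine le_trans ?_ h2
  rcases le_total 0 t with h0 | h0
  · have h3 : κ ≤ 2 + α / 2 - d * t := by
      have : 2 * β * (2 + α / 2 - d * t) = 4 * β + α * β - α ^ 2 + 2 * d * (β - 2) := by
        rw [ht]
        field_simp
        ring
      rw [← this] at hκ'
      exact le_of_mul_le_mul_left hκ' (by positivity)
    have := mul_le_mul_of_nonneg_right h3 ha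
    have := mul_nonneg h0 (sq_nonneg s)
    linarith
  · have h3 := mul_le_mul_of_nonpos_left hcs h0
    have h4 : κ ≤ 2 + (α : ℝ) / 2 := by
      have : (0 : ℝ) ≤ α / 2 := by positivity
      linarith
    have := mul_le_mul_of_nonneg_right h4 ha
    linarith

end Bochner

/-! ### Finiteness -/

section Ball

variable [G.LocallyFinite]

/-- Balls in a `d`-regular graph are finite, with a bound that depends only on `d` and on the
radius. -/
lemma Connected.exists_card_le_of_dist_le (hG : G.Connected)
    (hd : ∀ v, #(G.neighborFinset v) = d) (u : V) (r : ℕ) :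
    ∃ s : Finset V, (∀ v, G.dist u v ≤ r → v ∈ s) ∧ #s ≤ (d + 1) ^ r := by
  classical
  induction r with
  | zero =>
    refine ⟨{u}, fun v hv ↦ ?_, by simp⟩
    rw [mem_singleton, eq_comm, ← hG.dist_eq_zero_iff]
    omega
  | succ r ih =>
    obtain ⟨s, hs, hcard⟩ := ih
    refine ⟨s.biUnion fun v ↦ insert v (G.neighborFinset v), fun v hv ↦ ?_, ?_⟩
    · rw [mem_biUnion]
      by_cases h0 : G.dist v u = 0
      · rw [hG.dist_eq_zero_iff] at h0
        exact ⟨u, hs u (by simp), by simp [h0]⟩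
      · obtain ⟨p, hp⟩ := hG.exists_walk_length_eq_dist v u
        match p, hp with
        | .nil, hp => simp at h0
        | .cons (v := w) h q, hp =>
          refine ⟨w, hs w ?_, by simp [h.symm]⟩
          have := dist_le q
          rw [Walk.length_cons] at hp
          rw [dist_comm] at hv ⊢
          omega
    · rw [pow_succ]
      refine card_biUnion_le_card_mul _ _ _ (fun v _ ↦ ?_) |>.trans (Nat.mul_le_mul_right _ hcard)
      exact (card_insert_le _ _).trans (by rw [hd])

end Ball

/-- If there is a claw, the degree is so large that the curvature is at least `1 / 2`; the case
`α = 6β - 9` is the extremal one. -/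
lemma IsAmplyRegular.curvatureGE_half [G.LocallyFinite] (h : G.IsAmplyRegular n d α β)
    (hd : 0 < d) (hαβ : (α : ℤ) ≤ 6 * β - 9) (hdeg : 3 * α + 6 ≤ d + 3 * β) :
    G.CurvatureGE (1 / 2) := by
  have hβ : (2 : ℝ) ≤ β := by
    have : 2 ≤ β := by omega
    exact_mod_cast this
  have hαβ' : (α : ℝ) ≤ 6 * β - 9 := by exact_mod_cast hαβ
  have hdeg' : (3 : ℝ) * α + 6 ≤ d + 3 * β := by exact_mod_cast hdeg
  have hd0 : (0 : ℝ) ≤ d := Nat.cast_nonneg _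
  have hα0 : (0 : ℝ) ≤ α := Nat.cast_nonneg _
  classical
  refine h.curvatureGE hd (by omega) (by norm_num) ?_
  rcases le_total (α : ℝ) β with hle | hle
  · nlinarith [mul_nonneg hα0 (sub_nonneg.2 hle), mul_nonneg hd0 (sub_nonneg.2 hβ)]
  · -- After inserting the bound on `d`, the right-hand side is concave in `α`.
    nlinarith [mul_nonneg (sub_nonneg.2 hle) (sub_nonneg.2 hαβ'),
      mul_le_mul_of_nonneg_right hdeg' (sub_nonneg.2 hβ)]

theorem IsAmplyRegular.dist_le (h : G.IsAmplyRegular n d α β) (hG : G.Connected)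
    (hαβ : (α : ℤ) ≤ 6 * β - 9) (u v : V) : G.dist u v ≤ 4 * d := by
  have : G.LocallyFinite := fun v ↦
    (Set.finite_of_encard_eq_coe (h.degree_eq v)).fintype
  rcases lt_or_ge (G.dist u v) 4 with hlt | hge
  · rcases Nat.eq_zero_or_pos d with rfl | hd
    · obtain ⟨p, hp⟩ := hG.exists_walk_length_eq_dist u v
      cases p with
      | nil => simp
      | cons hadj _ =>
        have := h.card_neighborFinset u
        rw [card_eq_zero] at this
        simpa [this] using (G.mem_neighborFinset _ _).2 hadj
    · omega
  · obtain ⟨w, a, b, c, ha, hb, hc, hab, hac, hbc, hab', hac', hbc'⟩ :=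
      h.exists_claw hG (by omega) hge
    classical
    have hd : 0 < d := by
      rw [← h.card_neighborFinset w]
      exact card_pos.2 ⟨a, by simpa using ha⟩
    have hcurv := h.curvatureGE_half hd hαβ
      (h.three_mul_add_six_le_of_claw ha hb hc hab hac hbc hab' hac' hbc')
    have := hcurv.mul_dist_le h.card_neighborFinset hG (by norm_num) u v
    have : (G.dist u v : ℝ) ≤ 4 * d := by linarith
    exact_mod_cast this

lemma IsAmplyRegular.finite_and_card_le (h : G.IsAmplyRegular n d α β) (hG : G.Connected)
    (hαβ : (α : ℤ) ≤ 6 * β - 9) : Finite V ∧ Nat.card V ≤ (d + 1) ^ (4 * d) := by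
  have : G.LocallyFinite := fun v ↦
    (Set.finite_of_encard_eq_coe (h.degree_eq v)).fintype
  obtain ⟨u⟩ := hG.nonempty
  obtain ⟨s, hs, hcard⟩ := hG.exists_card_le_of_dist_le h.card_neighborFinset u (4 * d)
  have hmem (v : V) : v ∈ s := hs v (h.dist_le hG hαβ u v)
  have huniv : (Set.univ : Set V) ⊆ s := fun v _ ↦ hmem v
  refine ⟨Set.finite_univ_iff.1 (s.finite_toSet.subset huniv), ?_⟩
  rw [← Set.ncard_univ]
  exact (Set.ncard_le_ncard huniv).trans (by rwa [Set.ncard_coe_finset])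

end SimpleGraph

theorem mainTheorem2 :
    (∀ (V : Type u) (G : SimpleGraph V) (n : ℕ∞) (d α β : ℕ),
      G.Connected → G ≠ ⊤ → G ≠ ⊥ → G.IsAmplyRegular n d α β →
      (α : ℤ) ≤ 6 * (β : ℤ) - 9 →
        Finite V ∧ G.ediam ≤ 4 * (d : ℕ∞)) ∧
    (∀ d : ℕ, ∃ S : Set (Σ m : ℕ, SimpleGraph (Fin m)), S.Finite ∧
      ∀ (V : Type u) (G : SimpleGraph V) (n : ℕ∞) (α β : ℕ),
        G.Connected → G ≠ ⊤ → G ≠ ⊥ → G.IsAmplyRegular n d α β →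
        (α : ℤ) ≤ 6 * (β : ℤ) - 9 →
          ∃ H ∈ S, Nonempty (G ≃g H.2)) := by
  refine ⟨fun V G n d α β hG _ _ h hαβ ↦ ⟨(h.finite_and_card_le hG hαβ).1, ?_⟩, fun d ↦ ?_⟩
  · refine SimpleGraph.ediam_le_of_edist_le fun u v ↦ ?_
    rw [← (hG.preconnected u v).coe_dist_eq_edist]
    exact_mod_cast h.dist_le hG hαβ u v
  · refine ⟨⋃ m ∈ Set.Iic ((d + 1) ^ (4 * d)), Set.range (Sigma.mk m),
      (Set.finite_Iic _).biUnion fun _ _ ↦ Set.finite_range _, fun V G n α β hG _ _ h hαβ ↦ ?_⟩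
    obtain ⟨hfin, hcard⟩ := h.finite_and_card_le hG hαβ
    have := Fintype.ofFinite V
    rw [Nat.card_eq_fintype_card] at hcard
    exact ⟨⟨_, G.overFin rfl⟩, Set.mem_biUnion hcard ⟨_, rfl⟩, ⟨G.overFinIso rfl⟩⟩
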